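/- Let $m\ge 1$ and $0\le n<N$ be integers, let $\zeta_k=e^{ik\pi/N}$, let $\mathbb{T}_{2N}=\{\zeta_{-N+1},\dots,\zeta_N\}$ be the discrete unit circle, and let $\nu$ be the measure with mass $\frac1{2N}$ at each point of $\mathbb{T}_{2N}$, so that $\int f\,d\nu=\frac1{2N}\sum_{j=-N+1}^{N}f(\zeta_j)$. Let $\mathfrak{P}_+^{(m,n)}(N)$ be the cone of all $m\times m$ Hermitian pseudo-polynomials $Q(\zeta)=\sum_{k=-n}^{n}Q_k\zeta^{-k}$ with $Q_k\in\mathbb{C}^{m\times m}$ and $Q_{-k}=Q_k^*$, which are positive definite at every point of $\mathbb{T}_{2N}$. Let $\mathfrak{C}_+^{(m,n)}(N)$ be the set of all sequences $C=(C_0,\dots,C_n)$ of complex $m\times m$ matrices, with the convention $C_{-k}=C_k^*$ (so $C_0$ is Hermitian), such that $$\langle C,Q\rangle:=\sum_{k=-n}^{n}\operatorname{tr}\{C_kQ_k^*\}>0\quad\text{for all }Q\in\overline{\mathfrak{P}_+^{(m,n)}(N)}\setminus\{0\}.$$ Theorem. For each $(C,P)\in\mathfrak{C}_+^{(m,n)}(N)\times\mathfrak{P}_+^{(1,n)}(N)$,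 the problem to maximize the functional $$\mathbb{I}_P(\Phi)=\int P\,\log\det\Phi\,d\nu$$ over all functions $\Phi$ from $\mathbb{T}_{2N}$ to the positive definite Hermitian $m\times m$ matrices, subject to the moment conditions $$\int \zeta^{k}\,\Phi(\zeta)\,d\nu(\zeta)=C_k,\qquad k=0,1,\dots,n,$$ has a unique solution $\hat\Phi$, and it has the form $\hat\Phi(\zeta)=P(\zeta)\hat Q(\zeta)^{-1}$, where $\hat Q\in\mathfrak{P}_+^{(m,n)}(N)$ is the unique solution to the dual problem to minimize $$\mathbb{J}_P(Q)=\langle C,Q\rangle-\int P\,\log\det Q\,d\nu$$ over all $Q\in\mathfrak{P}_+^{(m,n)}(N)$. -/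

import Mathlib

noncomputable section

namespace PeriodicMoment

open Matrix
open scoped ComplexOrder

/-- The points `ζ_k = e^{ikπ/N}` of the unit circle. -/
def zeta (N : ℕ) (k : ℤ) : ℂ :=
  Complex.exp (Complex.I * ((k : ℂ) * (Real.pi : ℂ) / (N : ℂ)))

/-- The discrete unit circle `𝕋_{2N} = {ζ_k : -N+1 ≤ k ≤ N}`. -/
def discreteCircle (N : ℕ) : Set ℂ :=
  Set.range fun k : Finset.Icc (-(N : ℤ) + 1) (N : ℤ) => zeta N k

/-- The integral `∫ f dν` of a function on `𝕋_{2N}`, where `ν` has mass `1/(2N)` at each of the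
`2N` points `ζ_j`, `-N+1 ≤ j ≤ N`. -/
def nuIntegral {N : ℕ} {E : Type*} [AddCommMonoid E] [Module ℝ E]
    (f : discreteCircle N → E) : E :=
  (1 / (2 * (N : ℝ))) •
    ∑ j : Finset.Icc (-(N : ℤ) + 1) (N : ℤ), f ⟨zeta N j, j, rfl⟩

/-- The real vector space of bi-infinite sequences `(A_k)` of complex `m × m` matrices such that
`A_{-k} = A_k^*` for all `k` and `A_k = 0` for `|k| > n`. Such a sequence is the same thing as
`(A_0, …, A_n)` with `A_0` Hermitian. It serves both as a sequence of covariance lags and as the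
coefficient sequence of a Hermitian pseudo-polynomial of degree at most `n`. -/
def HermSeq (m n : ℕ) : Submodule ℝ (ℤ → Matrix (Fin m) (Fin m) ℂ) where
  carrier := {A | (∀ k, A (-k) = (A k)ᴴ) ∧ ∀ k, (n : ℤ) < |k| → A k = 0}
  zero_mem' := by simp
  add_mem' := by
    rintro A B ⟨hA, hA'⟩ ⟨hB, hB'⟩
    refine ⟨fun k => ?_, fun k hk => ?_⟩
    · simp [hA k, hB k]
    · simp [hA' k hk, hB' k hk]
  smul_mem' := by
    rintro c A ⟨hA, hA'⟩
    refine ⟨fun k => ?_, fun k hk => ?_⟩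
    · simp [hA k, Matrix.conjTranspose_smul]
    · simp [hA' k hk]

/-- The value `Q(z) = ∑_{k=-n}^{n} Q_k z^{-k}` of a pseudo-polynomial. -/
def eval {m n : ℕ} (Q : HermSeq m n) (z : ℂ) : Matrix (Fin m) (Fin m) ℂ :=
  ∑ k ∈ Finset.Icc (-(n : ℤ)) (n : ℤ), z ^ (-k) • (Q : ℤ → Matrix (Fin m) (Fin m) ℂ) k

/-- The (real) value of a scalar pseudo-polynomial, that is, of the case `m = 1`, on the circle. -/
def scalarEval {n : ℕ} (P : HermSeq 1 n) (z : ℂ) : ℝ := (eval P z 0 0).re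

/-- The cone `𝔓₊^{(m,n)}(N)` of pseudo-polynomials that are positive definite on `𝕋_{2N}`. -/
def posCone (m n N : ℕ) : Set (HermSeq m n) :=
  {Q | ∀ z ∈ discreteCircle N, (eval Q z).PosDef}

/-- The pairing `⟨C, Q⟩ = ∑_{k=-n}^{n} tr (C_k Q_k^*)`. The sum is real, as the terms for `k` and
`-k` are complex conjugates. -/
def pairing {m n : ℕ} (C Q : HermSeq m n) : ℝ :=
  (∑ k ∈ Finset.Icc (-(n : ℤ)) (n : ℤ),
    Matrix.trace ((C : ℤ → Matrix (Fin m) (Fin m) ℂ) k *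
      ((Q : ℤ → Matrix (Fin m) (Fin m) ℂ) k)ᴴ)).re

/-- The dual cone `ℭ₊^{(m,n)}(N)`: all `C` with `⟨C, Q⟩ > 0` for every nonzero `Q` in the closure
of `𝔓₊^{(m,n)}(N)`. -/
def dualCone (m n N : ℕ) : Set (HermSeq m n) :=
  {C | ∀ Q ∈ closure (posCone m n N) \ {0}, 0 < pairing C Q}

/-- `log det A` for a positive definite matrix `A`, whose determinant is a positive real. -/
def logDet {m : ℕ} (A : Matrix (Fin m) (Fin m) ℂ) : ℝ := Real.log A.det.re

/-- The positive definite matrix functions `Φ` on `𝕋_{2N}` that satisfy the moment conditions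
`∫ e^{ikθ} Φ(e^{iθ}) dν = C_k` for `k = 0, 1, …, n`. -/
def feasible {m n : ℕ} (N : ℕ) (C : HermSeq m n) :
    Set (discreteCircle N → Matrix (Fin m) (Fin m) ℂ) :=
  {Φ | (∀ z, (Φ z).PosDef) ∧
    ∀ k : ℕ, k ≤ n →
      nuIntegral (fun z => (z : ℂ) ^ k • Φ z) = (C : ℤ → Matrix (Fin m) (Fin m) ℂ) k}

/-- The primal functional `𝕀_P(Φ) = ∫ P log det Φ dν`. -/
def primal {m n N : ℕ} (P : HermSeq 1 n) (Φ : discreteCircle N → Matrix (Fin m) (Fin m) ℂ) : ℝ :=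
  nuIntegral fun z => scalarEval P z * logDet (Φ z)

/-- The dual functional `𝕁_P(Q) = ⟨C, Q⟩ - ∫ P log det Q dν`. -/
def dual {m n : ℕ} (N : ℕ) (C : HermSeq m n) (P : HermSeq 1 n) (Q : HermSeq m n) : ℝ :=
  pairing C Q - nuIntegral fun z : discreteCircle N => scalarEval P z * logDet (eval Q z)

/-- The matrix function `P Q⁻¹` on `𝕋_{2N}`. -/
def ratio {m n : ℕ} (N : ℕ) (P : HermSeq 1 n) (Q : HermSeq m n) :
    discreteCircle N → Matrix (Fin m) (Fin m) ℂ :=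
  fun z => (scalarEval P z : ℂ) • (eval Q z)⁻¹

end PeriodicMoment

end

open PeriodicMoment

/-!
Everything rests on the concavity inequality
`log det B ≤ log det A + tr (A⁻¹ B) - m` for positive definite `A`, `B`, with equality only for
`B = A` (`logDet_le`, `eq_of_logDet_eq`); in the eigenvalues of `A^{-1/2} B A^{-1/2}` it says
`log x ≤ x - 1`.

*The dual problem.* Since `2n < 2N`, a pseudo-polynomial is determined by its values on the
discrete circle, so that pseudo-polynomials that are nonnegative there and have bounded mean trace
form a compact set. Hence `⟨C, Q⟩ ≥ c ∫ tr Q dν` for some `c > 0`, and as `log det` is dominated by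
any small multiple of the trace, `𝕁_P` grows at least linearly in the mean trace
(`exists_dual_ge`). The function `exp (-𝕁_P)` is a product of positive powers of determinants and
an exponential; it extends continuously by zero to the boundary of the cone, so it has a maximum,
and that maximum, being positive, is attained at an interior point `Q̂` (`exists_isMinOn_dual`).
The cone is open, so the derivative of `𝕁_P` vanishes at `Q̂`, that is,
`⟨C, H⟩ = ∫ P tr (Q̂⁻¹ H) dν` for all `H` (`pairing_eq_of_isMinOn`). With the equality case of the
concavity inequality this makes `Q̂` the only minimizer (`eq_of_isMinOn_dual`).

*The primal problem.* Stationarity says that the moments of `Φ̂ = P Q̂⁻¹` pair with every `H` as `C`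
does, so they are equal to `C` (`ratio_mem_feasible`). For a feasible `Φ`, the concavity inequality
at `Φ̂`, multiplied by `P` and integrated, reads
`𝕀_P(Φ) ≤ 𝕀_P(Φ̂) + ∫ tr (Q̂ Φ) dν - ∫ tr (Q̂ Φ̂) dν`. Both integrals are `⟨C, Q̂⟩`, since
they depend on the moments only. So `Φ̂` is a maximizer, and the equality case makes it the only one
(`isMaxOn_primal`, `eq_ratio_of_isMaxOn`).
-/

noncomputable section

namespace PeriodicMoment

open Matrix Filter Topology
open scoped ComplexOrder

/-! ### Positive definite matrices and `log det` -/

section Matrices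

variable {m : ℕ} {A B : Matrix (Fin m) (Fin m) ℂ}

theorem det_re_pos (hA : A.PosDef) : 0 < A.det.re :=
  (Complex.pos_iff.mp hA.det_pos).1

theorem det_im_eq_zero (hA : A.PosSemidef) : A.det.im = 0 :=
  ((Complex.nonneg_iff.mp hA.det_nonneg).2).symm

theorem trace_re_nonneg (hA : A.PosSemidef) : 0 ≤ A.trace.re :=
  (Complex.nonneg_iff.mp hA.trace_nonneg).1

theorem det_re_eq_prod_eigenvalues (hA : A.IsHermitian) :
    A.det.re = ∏ i, hA.eigenvalues i := by
  rw [hA.det_eq_prod_eigenvalues]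
  norm_cast

theorem trace_re_eq_sum_eigenvalues (hA : A.IsHermitian) :
    A.trace.re = ∑ i, hA.eigenvalues i := by
  rw [hA.trace_eq_sum_eigenvalues]
  norm_cast

/-- In terms of the eigenvalues this is `log x ≤ x - 1`. -/
theorem logDet_le_trace_sub (hA : A.PosDef) : logDet A ≤ A.trace.re - m := by
  rw [logDet, det_re_eq_prod_eigenvalues hA.1, trace_re_eq_sum_eigenvalues hA.1,
    Real.log_prod fun i _ => (hA.eigenvalues_pos i).ne']
  calc ∑ i, Real.log (hA.1.eigenvalues i) ≤ ∑ i, (hA.1.eigenvalues i - 1) :=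
        Finset.sum_le_sum fun i _ => Real.log_le_sub_one_of_pos (hA.eigenvalues_pos i)
    _ = _ := by simp

theorem eq_one_of_logDet_eq (hA : A.PosDef) (h : logDet A = A.trace.re - m) : A = 1 := by
  rw [logDet, det_re_eq_prod_eigenvalues hA.1, trace_re_eq_sum_eigenvalues hA.1,
    Real.log_prod fun i _ => (hA.eigenvalues_pos i).ne'] at h
  have h' : ∑ i, Real.log (hA.1.eigenvalues i) = ∑ i, (hA.1.eigenvalues i - 1) := by
    rw [h]; simp
  rw [Finset.sum_eq_sum_iff_of_le
    fun i _ => Real.log_le_sub_one_of_pos (hA.eigenvalues_pos i)] at h'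
  have h1 : hA.1.eigenvalues = 1 := by
    funext i
    by_contra hne
    exact (Real.log_lt_sub_one_of_pos (hA.eigenvalues_pos i) hne).ne (h' i (Finset.mem_univ i))
  have := hA.1.spectral_theorem
  rw [h1] at this
  simpa [Function.comp_def] using this

theorem logDet_mul (hA : A.PosDef) (hB : B.PosDef) :
    Real.log (A * B).det.re = logDet A + logDet B := by
  rw [det_mul, Complex.mul_re, det_im_eq_zero hA.posSemidef, zero_mul, sub_zero,
    Real.log_mul (det_re_pos hA).ne' (det_re_pos hB).ne', logDet, logDet]

theorem logDet_inv (hA : A.PosDef) : logDet A⁻¹ = -logDet A := by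
  have h := logDet_mul hA hA.inv
  rw [mul_nonsing_inv _ ((isUnit_iff_isUnit_det _).mp hA.isUnit)] at h
  simp at h
  linarith

open scoped MatrixOrder in
/-- A positive definite `A⁻¹ = Sᴴ S` turns `B` into the positive definite `S B Sᴴ`, whose trace
and determinant are those of `A⁻¹ B`. -/
theorem exists_congruence (hA : A.PosDef) (hB : B.PosDef) :
    ∃ X : Matrix (Fin m) (Fin m) ℂ, X.PosDef ∧ X.trace = (A⁻¹ * B).trace ∧
      logDet X = logDet B - logDet A ∧ (X = 1 → B = A) := by
  obtain ⟨S, hS⟩ := CStarAlgebra.nonneg_iff_eq_star_mul_self.mp hA.inv.posSemidef.nonneg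
  rw [star_eq_conjTranspose] at hS
  have hSu : IsUnit S := by
    have h := (isUnit_iff_isUnit_det _).mp hA.inv.isUnit
    rw [hS, det_mul] at h
    exact (isUnit_iff_isUnit_det _).mpr (isUnit_of_mul_isUnit_right h)
  refine ⟨S * B * Sᴴ, ?_, ?_, ?_, ?_⟩
  · exact (hSu.posDef_star_right_conjugate_iff).mpr hB
  · rw [hS, trace_mul_comm, Matrix.mul_assoc]
  · have h := logDet_mul hA.inv hB
    rw [logDet_inv hA] at h
    rw [logDet, show (S * B * Sᴴ).det = (A⁻¹ * B).det by rw [hS]; simp only [det_mul]; ring, h]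
    ring
  · intro h
    have hSd := (isUnit_iff_isUnit_det _).mp hSu
    have h1 : B * Sᴴ = S⁻¹ := by
      rw [Matrix.mul_assoc] at h
      exact (inv_eq_right_inv h).symm
    have h2 : B * A⁻¹ = 1 := by
      rw [hS, ← Matrix.mul_assoc, h1, nonsing_inv_mul _ hSd]
    rw [← inv_eq_left_inv h2, nonsing_inv_nonsing_inv _ ((isUnit_iff_isUnit_det _).mp hA.isUnit)]

/-- Concavity of `log det`: its graph lies below the tangent hyperplane at `A`. -/
theorem logDet_le (hA : A.PosDef) (hB : B.PosDef) :
    logDet B ≤ logDet A + ((A⁻¹ * B).trace.re - m) := by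
  obtain ⟨X, hX, ht, hl, -⟩ := exists_congruence hA hB
  have := logDet_le_trace_sub hX
  rw [ht, hl] at this
  linarith

/-- Strict concavity of `log det`. -/
theorem eq_of_logDet_eq (hA : A.PosDef) (hB : B.PosDef)
    (h : logDet B = logDet A + ((A⁻¹ * B).trace.re - m)) : B = A := by
  obtain ⟨X, hX, ht, hl, h1⟩ := exists_congruence hA hB
  refine h1 (eq_one_of_logDet_eq hX ?_)
  rw [ht, hl]
  linarith

/-- The entries of a positive semidefinite matrix are bounded by its trace, because its
`2 × 2` principal minors are nonnegative. -/
theorem norm_apply_le_trace (hA : A.PosSemidef) (a b : Fin m) : ‖A a b‖ ≤ A.trace.re := by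
  have hd : ∀ i, 0 ≤ (A i i).re := fun i => (Complex.nonneg_iff.mp hA.diag_nonneg).1
  have hd' : ∀ i, (A i i).im = 0 := fun i => (Complex.nonneg_iff.mp hA.diag_nonneg).2.symm
  have hle : ∀ i, (A i i).re ≤ A.trace.re := fun i => by
    simp only [trace, diag_apply, Complex.re_sum]
    exact Finset.single_le_sum (f := fun i => (A i i).re) (fun i _ => hd i) (Finset.mem_univ i)
  have h := (Complex.nonneg_iff.mp (hA.submatrix ![a, b]).det_nonneg).1
  have hba : A b a = star (A a b) := (hA.1.apply b a).symm
  simp only [det_fin_two, submatrix_apply, cons_val_zero, cons_val_one, hba, Complex.sub_re,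
    Complex.mul_re, hd', Complex.star_def, Complex.conj_re, Complex.conj_im] at h
  have h2 : ‖A a b‖ ^ 2 = (A a b).re * (A a b).re + (A a b).im * (A a b).im := by
    rw [← Complex.normSq_eq_norm_sq, Complex.normSq_apply]
  have h3 : (A a a).re * (A b b).re ≤ A.trace.re * A.trace.re :=
    mul_le_mul (hle a) (hle b) (hd b) (trace_re_nonneg hA)
  refine le_of_sq_le_sq ?_ (trace_re_nonneg hA)
  rw [h2]
  nlinarith

theorem isClosed_posSemidef : IsClosed {A : Matrix (Fin m) (Fin m) ℂ | A.PosSemidef} := by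
  simp only [posSemidef_iff_dotProduct_mulVec, Set.ofPred_and, Set.ofPred_forall]
  refine IsClosed.inter ?_ (isClosed_iInter fun x => ?_)
  · exact isClosed_eq (by fun_prop) continuous_id
  · exact isClosed_le continuous_const (by fun_prop)

theorem isCompact_posSemidef_trace_le (R : ℝ) :
    IsCompact {A : Matrix (Fin m) (Fin m) ℂ | A.PosSemidef ∧ A.trace.re ≤ R} := by
  have hK : IsCompact (Set.univ.pi fun _ : Fin m => Set.univ.pi fun _ : Fin m =>
      Metric.closedBall (0 : ℂ) R) :=
    isCompact_univ_pi fun _ => isCompact_univ_pi fun _ => isCompact_closedBall _ _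
  refine hK.of_isClosed_subset ?_ ?_
  · exact isClosed_posSemidef.inter (isClosed_le (f := fun A : Matrix (Fin m) (Fin m) ℂ =>
      A.trace.re) (by fun_prop) continuous_const)
  · rintro A ⟨hA, hR⟩ a - b -
    simpa using (norm_apply_le_trace hA a b).trans hR

end Matrices

/-! ### Integration on the discrete circle -/

section Integral

variable {N : ℕ} {E F : Type*} [AddCommGroup E] [Module ℝ E] [AddCommGroup F] [Module ℝ F]

theorem nuIntegral_add (f g : discreteCircle N → E) :
    nuIntegral (fun z => f z + g z) = nuIntegral f + nuIntegral g := by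
  simp [nuIntegral, Finset.sum_add_distrib]

theorem nuIntegral_sub (f g : discreteCircle N → E) :
    nuIntegral (fun z => f z - g z) = nuIntegral f - nuIntegral g := by
  simp [nuIntegral, Finset.sum_sub_distrib, smul_sub]

theorem map_nuIntegral (L : E →ₗ[ℝ] F) (f : discreteCircle N → E) :
    L (nuIntegral f) = nuIntegral fun z => L (f z) := by
  simp [nuIntegral]

theorem nuIntegral_smul (c : ℝ) (f : discreteCircle N → E) :
    nuIntegral (fun z => c • f z) = c • nuIntegral f :=
  (map_nuIntegral (c • LinearMap.id) f).symm

theorem nuIntegral_mul_left (c : ℝ) (f : discreteCircle N → ℝ) :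
    nuIntegral (fun z => c * f z) = c * nuIntegral f :=
  nuIntegral_smul c f

theorem nuIntegral_sum {ι : Type*} (s : Finset ι) (f : ι → discreteCircle N → E) :
    nuIntegral (fun z => ∑ i ∈ s, f i z) = ∑ i ∈ s, nuIntegral (f i) := by
  simp only [nuIntegral, ← Finset.smul_sum]
  rw [Finset.sum_comm]

theorem nuIntegral_mono {f g : discreteCircle N → ℝ} (h : ∀ z, f z ≤ g z) :
    nuIntegral f ≤ nuIntegral g :=
  smul_le_smul_of_nonneg_left (Finset.sum_le_sum fun _ _ => h _) (by positivity)

theorem eq_of_nuIntegral_eq_of_le (hN : 0 < N) {f g : discreteCircle N → ℝ}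
    (hle : ∀ z, f z ≤ g z) (h : nuIntegral f = nuIntegral g) (z : discreteCircle N) :
    f z = g z := by
  have hc : (1 / (2 * (N : ℝ))) ≠ 0 := by positivity
  have h' := (Finset.sum_eq_sum_iff_of_le fun _ _ => hle _).mp (smul_right_injective ℝ hc h)
  obtain ⟨_, j, rfl⟩ := z
  exact h' j (Finset.mem_univ j)

theorem nuIntegral_nonneg {f : discreteCircle N → ℝ} (h : ∀ z, 0 ≤ f z) : 0 ≤ nuIntegral f :=
  smul_nonneg (by positivity) (Finset.sum_nonneg fun _ _ => h _)

theorem continuous_nuIntegral {X : Type*} [TopologicalSpace X]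
    {f : X → discreteCircle N → ℝ} (hf : ∀ z, Continuous fun x => f x z) :
    Continuous fun x => nuIntegral (f x) := by
  unfold nuIntegral
  fun_prop

end Integral

/-! ### Orthogonality of the characters -/

section Orthogonality

variable {N : ℕ}

theorem zeta_eq_zpow (N : ℕ) (j : ℤ) : zeta N j = zeta N 1 ^ j := by
  rw [zeta, zeta, ← Complex.exp_int_mul]
  congr 1
  push_cast
  ring

theorem norm_zeta (N : ℕ) (j : ℤ) : ‖zeta N j‖ = 1 := by
  rw [zeta, show Complex.I * ((j : ℂ) * (Real.pi : ℂ) / (N : ℂ)) =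
    ((j * Real.pi / N : ℝ) : ℂ) * Complex.I by push_cast; ring, Complex.norm_exp_ofReal_mul_I]

theorem norm_coe_discreteCircle (z : discreteCircle N) : ‖(z : ℂ)‖ = 1 := by
  obtain ⟨_, j, rfl⟩ := z
  exact norm_zeta N j

theorem coe_discreteCircle_ne_zero (z : discreteCircle N) : (z : ℂ) ≠ 0 :=
  norm_ne_zero_iff.mp (by rw [norm_coe_discreteCircle]; exact one_ne_zero)

theorem star_coe_discreteCircle (z : discreteCircle N) : star (z : ℂ) = (z : ℂ)⁻¹ :=
  (Complex.inv_eq_conj (norm_coe_discreteCircle z)).symm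

instance : Finite (discreteCircle N) := Set.finite_range _

theorem zeta_one_zpow_eq_one_iff (hN : 0 < N) (k : ℤ) :
    zeta N 1 ^ k = 1 ↔ (2 * N : ℤ) ∣ k := by
  have hN' : (N : ℂ) ≠ 0 := by exact_mod_cast hN.ne'
  have hpi : (Real.pi : ℂ) ≠ 0 := by exact_mod_cast Real.pi_ne_zero
  rw [← zeta_eq_zpow, zeta, Complex.exp_eq_one_iff]
  refine exists_congr fun l => ?_
  constructor
  · intro h
    have h1 : Complex.I * Real.pi * (k : ℂ) = Complex.I * Real.pi * (2 * N * l) := by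
      field_simp at h ⊢
      linear_combination h
    exact_mod_cast mul_left_cancel₀ (mul_ne_zero Complex.I_ne_zero hpi) h1
  · rintro rfl
    push_cast
    field_simp

/-- The sum of the powers of `w` over a full period is invariant under multiplication by `w`. -/
theorem sum_zpow_eq_zero {w : ℂ} (hw : w ^ (2 * N : ℤ) = 1) (hw1 : w ≠ 1) :
    ∑ j ∈ Finset.Icc (-(N : ℤ) + 1) N, w ^ j = 0 := by
  rcases Nat.eq_zero_or_pos N with rfl | hN
  · simp
  have hw0 : w ≠ 0 := by
    rintro rfl
    rw [_root_.zero_zpow _ (by omega)] at hw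
    exact zero_ne_one hw
  have hshift : w * ∑ j ∈ Finset.Icc (-(N : ℤ) + 1) N, w ^ j =
      ∑ j ∈ Finset.Icc (-(N : ℤ) + 2) (N + 1), w ^ j := by
    rw [Finset.mul_sum]
    refine Finset.sum_bij (fun j _ => j + 1) ?_ ?_ ?_ ?_
    · intro j hj; rw [Finset.mem_Icc] at hj ⊢; omega
    · intro i _ j _ h; omega
    · intro j hj; rw [Finset.mem_Icc] at hj
      exact ⟨j - 1, Finset.mem_Icc.mpr (by omega), by omega⟩
    · intro j _; rw [zpow_add_one₀ hw0, mul_comm]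
  have hends : w ^ ((N : ℤ) + 1) = w ^ (-(N : ℤ) + 1) := by
    rw [show (N : ℤ) + 1 = 2 * N + (-(N : ℤ) + 1) by ring, zpow_add₀ hw0, hw, one_mul]
  have h1 : Finset.Icc (-(N : ℤ) + 1) N =
      insert (-(N : ℤ) + 1) (Finset.Icc (-(N : ℤ) + 2) N) := by
    ext j; simp only [Finset.mem_insert, Finset.mem_Icc]; omega
  have h2 : Finset.Icc (-(N : ℤ) + 2) (N + 1) =
      insert ((N : ℤ) + 1) (Finset.Icc (-(N : ℤ) + 2) N) := by
    ext j; simp only [Finset.mem_insert, Finset.mem_Icc]; omega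
  have hinv : w * ∑ j ∈ Finset.Icc (-(N : ℤ) + 1) N, w ^ j =
      ∑ j ∈ Finset.Icc (-(N : ℤ) + 1) N, w ^ j := by
    rw [hshift, h1, h2, Finset.sum_insert (by simp), Finset.sum_insert (by simp), hends]
  have : (w - 1) * ∑ j ∈ Finset.Icc (-(N : ℤ) + 1) N, w ^ j = 0 := by
    rw [sub_mul, hinv]; ring
  exact (mul_eq_zero.mp this).resolve_left (sub_ne_zero.mpr hw1)

theorem nuIntegral_zpow {k : ℤ} (hk : |k| < 2 * N) :
    nuIntegral (fun z : discreteCircle N => (z : ℂ) ^ k) = if k = 0 then 1 else 0 := by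
  have hN : 0 < N := by have := abs_nonneg k; omega
  have hN' : (N : ℂ) ≠ 0 := by exact_mod_cast hN.ne'
  split_ifs with h
  · subst h
    have : (2 * (N : ℂ))⁻¹ * (2 * N) = 1 := by field_simp
    have hc : ((N : ℤ) + N).toNat = 2 * N := by omega
    simpa [nuIntegral, hc] using this
  · have hw1 : zeta N 1 ^ k ≠ 1 := by
      rw [Ne, zeta_one_zpow_eq_one_iff hN]
      intro hd
      exact h (Int.eq_zero_of_abs_lt_dvd hd hk)
    have hw : (zeta N 1 ^ k) ^ (2 * N : ℤ) = 1 := by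
      rw [← _root_.zpow_mul, zeta_one_zpow_eq_one_iff hN]
      exact dvd_mul_left _ _
    have hs := sum_zpow_eq_zero hw hw1
    rw [← Finset.sum_coe_sort] at hs
    rw [nuIntegral]
    simp only [zeta_eq_zpow N (Subtype.val _)]
    simp only [← _root_.zpow_mul] at hs ⊢
    simp only [mul_comm] at hs ⊢
    rw [hs, smul_zero]

end Orthogonality

/-! ### Pseudo-polynomials and their values on the circle -/

section Eval

variable {m n N : ℕ}

theorem coeff_neg (A : HermSeq m n) (k : ℤ) : A.1 (-k) = (A.1 k)ᴴ := A.2.1 k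

theorem coeff_eq_zero (A : HermSeq m n) {k : ℤ} (hk : (n : ℤ) < |k|) : A.1 k = 0 :=
  A.2.2 k hk

/-- Evaluation at `z` as a linear map. -/
def evalLinear (m n : ℕ) (z : ℂ) : HermSeq m n →ₗ[ℝ] Matrix (Fin m) (Fin m) ℂ where
  toFun Q := eval Q z
  map_add' Q R := by simp [eval, Finset.sum_add_distrib]
  map_smul' c Q := by simp [eval, Finset.smul_sum, smul_comm c]

theorem eval_add (Q R : HermSeq m n) (z : ℂ) : eval (Q + R) z = eval Q z + eval R z :=
  map_add (evalLinear m n z) Q R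

theorem eval_sub (Q R : HermSeq m n) (z : ℂ) : eval (Q - R) z = eval Q z - eval R z :=
  map_sub (evalLinear m n z) Q R

theorem eval_smul (c : ℝ) (Q : HermSeq m n) (z : ℂ) : eval (c • Q) z = c • eval Q z :=
  map_smul (evalLinear m n z) c Q

theorem sum_Icc_neg {M : Type*} [AddCommMonoid M] (f : ℤ → M) :
    ∑ k ∈ Finset.Icc (-(n : ℤ)) n, f (-k) = ∑ k ∈ Finset.Icc (-(n : ℤ)) n, f k :=
  Finset.sum_nbij' (fun k => -k) (fun k => -k) (by simp; omega) (by simp; omega)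
    (by simp) (by simp) (by simp)

theorem eval_eq_sum_conjTranspose (Q : HermSeq m n) (z : ℂ) :
    eval Q z = ∑ k ∈ Finset.Icc (-(n : ℤ)) n, z ^ k • (Q.1 k)ᴴ := by
  rw [eval, ← sum_Icc_neg]
  simp [coeff_neg]

theorem isHermitian_eval (Q : HermSeq m n) (z : discreteCircle N) :
    (eval Q (z : ℂ)).IsHermitian := by
  rw [IsHermitian]
  conv_rhs => rw [eval_eq_sum_conjTranspose]
  simp [eval, conjTranspose_sum, conjTranspose_smul, star_zpow₀, star_coe_discreteCircle,
    -RCLike.star_def]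

/-- The coefficients of a pseudo-polynomial are the Fourier coefficients of its restriction to
the discrete circle, since `2n < 2N`. -/
theorem nuIntegral_zpow_smul_eval (hn : n < N) (Q : HermSeq m n) {k : ℤ} (hk : |k| ≤ n) :
    nuIntegral (fun z : discreteCircle N => (z : ℂ) ^ k • eval Q (z : ℂ)) = Q.1 k := by
  have hterm : ∀ l ∈ Finset.Icc (-(n : ℤ)) n,
      nuIntegral (fun z : discreteCircle N => (z : ℂ) ^ (k - l) • Q.1 l) =
        if l = k then Q.1 l else 0 := by
    intro l hl
    rw [Finset.mem_Icc] at hl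
    have h := map_nuIntegral ((LinearMap.toSpanSingleton ℂ _ (Q.1 l)).restrictScalars ℝ)
      fun z : discreteCircle N => (z : ℂ) ^ (k - l)
    rw [nuIntegral_zpow (by rw [abs_lt]; rw [abs_le] at hk; omega)] at h
    simp only [LinearMap.coe_restrictScalars, LinearMap.toSpanSingleton_apply] at h
    rw [← h]
    simp [sub_eq_zero, eq_comm]
  have hfun : (fun z : discreteCircle N => (z : ℂ) ^ k • eval Q (z : ℂ)) =
      fun z : discreteCircle N => ∑ l ∈ Finset.Icc (-(n : ℤ)) n, (z : ℂ) ^ (k - l) • Q.1 l := by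
    funext z
    simp [eval, Finset.smul_sum, smul_smul, zpow_sub₀ (coe_discreteCircle_ne_zero z),
      div_eq_mul_inv]
  rw [hfun, nuIntegral_sum, Finset.sum_congr rfl hterm]
  simp [Finset.mem_Icc, abs_le.mp hk]

theorem ext_of_eval (hn : n < N) {Q R : HermSeq m n}
    (h : ∀ z : discreteCircle N, eval Q (z : ℂ) = eval R (z : ℂ)) : Q = R := by
  refine Subtype.ext (funext fun k => ?_)
  rcases le_or_gt |k| (n : ℤ) with hk | hk
  · rw [← nuIntegral_zpow_smul_eval hn Q hk, ← nuIntegral_zpow_smul_eval hn R hk]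
    simp only [h]
  · rw [coeff_eq_zero Q hk, coeff_eq_zero R hk]

/-- Restriction of a pseudo-polynomial to the discrete circle. -/
def restrict (m n N : ℕ) :
    HermSeq m n →ₗ[ℝ] (discreteCircle N → Matrix (Fin m) (Fin m) ℂ) :=
  LinearMap.pi fun z => evalLinear m n z

theorem restrict_injective (hn : n < N) : Function.Injective (restrict m n N) :=
  fun _ _ h => ext_of_eval hn fun z => congrFun h z

instance : FiniteDimensional ℝ (HermSeq m n) :=
  haveI : Module.Finite ℝ (Matrix (Fin m) (Fin m) ℂ) := Module.Finite.matrix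
  FiniteDimensional.of_injective (restrict m n (n + 1)) (restrict_injective n.lt_succ_self)

theorem isClosedEmbedding_restrict (hn : n < N) :
    IsClosedEmbedding (restrict m n N) :=
  LinearMap.isClosedEmbedding_of_injective (𝕜 := ℝ)
    (LinearMap.ker_eq_bot.mpr (restrict_injective hn))

theorem continuous_eval (z : ℂ) : Continuous fun Q : HermSeq m n => eval Q z :=
  (evalLinear m n z).continuous_of_finiteDimensional

end Eval

/-! ### The pairing and the moments -/

section Pairing

variable {m n N : ℕ}

/-- The pairing with `C` as a linear form. -/
def pairingLinear (C : HermSeq m n) : HermSeq m n →ₗ[ℝ] ℝ where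
  toFun := pairing C
  map_add' Q R := by
    simp [pairing, Matrix.mul_add, Finset.sum_add_distrib]
  map_smul' c Q := by
    simp [pairing, conjTranspose_smul, Finset.mul_sum]

theorem pairing_sub_right (C Q R : HermSeq m n) :
    pairing C (Q - R) = pairing C Q - pairing C R :=
  map_sub (pairingLinear C) Q R

theorem pairing_add_right (C Q R : HermSeq m n) :
    pairing C (Q + R) = pairing C Q + pairing C R :=
  map_add (pairingLinear C) Q R

theorem pairing_smul_right (c : ℝ) (C Q : HermSeq m n) :
    pairing C (c • Q) = c * pairing C Q :=
  map_smul (pairingLinear C) c Q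

theorem continuous_pairing (C : HermSeq m n) : Continuous (pairing C) :=
  (pairingLinear C).continuous_of_finiteDimensional

theorem pairing_sub_left (C D Q : HermSeq m n) :
    pairing (C - D) Q = pairing C Q - pairing D Q := by
  simp [pairing, Matrix.sub_mul]

theorem eq_zero_of_pairing_self {C : HermSeq m n} (h : pairing C C = 0) : C = 0 := by
  have hterm : ∀ k : ℤ, 0 ≤ (trace (C.1 k * (C.1 k)ᴴ)).re := fun k =>
    trace_re_nonneg (posSemidef_self_mul_conjTranspose _)
  rw [pairing, Complex.re_sum, Finset.sum_eq_zero_iff_of_nonneg fun k _ => hterm k] at h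
  refine Subtype.ext (funext fun k => ?_)
  rcases le_or_gt |k| (n : ℤ) with hk | hk
  · refine trace_mul_conjTranspose_self_eq_zero_iff.mp (Complex.ext (h k ?_) ?_)
    · rw [Finset.mem_Icc]; exact abs_le.mp hk
    · exact (Complex.nonneg_iff.mp
        (posSemidef_self_mul_conjTranspose (C.1 k)).trace_nonneg).2.symm
  · exact coeff_eq_zero C hk

theorem conjTranspose_nuIntegral (f : discreteCircle N → Matrix (Fin m) (Fin m) ℂ) :
    (nuIntegral f)ᴴ = nuIntegral fun z => (f z)ᴴ := by
  simp [nuIntegral, conjTranspose_sum, conjTranspose_smul]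

/-- The moments `∫ z^k Φ dν`, `|k| ≤ n`, of a Hermitian matrix function. -/
def moments (n : ℕ) (Φ : discreteCircle N → Matrix (Fin m) (Fin m) ℂ)
    (hΦ : ∀ z, (Φ z).IsHermitian) : HermSeq m n :=
  ⟨fun k => if |k| ≤ n then nuIntegral fun z => (z : ℂ) ^ k • Φ z else 0, by
    intro k
    by_cases h : |k| ≤ n
    · simp only [abs_neg, h, if_true, conjTranspose_nuIntegral, conjTranspose_smul, (hΦ _).eq,
        star_zpow₀, star_coe_discreteCircle, _root_.inv_zpow']
    · simp [h], fun k hk => if_neg hk.not_ge⟩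

theorem pairing_moments {Φ : discreteCircle N → Matrix (Fin m) (Fin m) ℂ}
    (hΦ : ∀ z, (Φ z).IsHermitian) (Q : HermSeq m n) :
    pairing (moments n Φ hΦ) Q = nuIntegral fun z => (Φ z * eval Q (z : ℂ)).trace.re := by
  have h : ∀ z : discreteCircle N, (Φ z * eval Q (z : ℂ)).trace.re =
      ∑ k ∈ Finset.Icc (-(n : ℤ)) n, ((z : ℂ) ^ k • Φ z * (Q.1 k)ᴴ).trace.re := by
    intro z
    simp [eval_eq_sum_conjTranspose, Matrix.mul_sum, trace_sum]
  simp only [h, nuIntegral_sum]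
  rw [pairing, Complex.re_sum]
  refine Finset.sum_congr rfl fun k hk => ?_
  rw [Finset.mem_Icc, ← abs_le] at hk
  let L : Matrix (Fin m) (Fin m) ℂ →ₗ[ℝ] ℝ :=
    { toFun A := (A * (Q.1 k)ᴴ).trace.re
      map_add' A B := by simp [Matrix.add_mul]
      map_smul' c A := by simp }
  have := map_nuIntegral L fun z : discreteCircle N => (z : ℂ) ^ k • Φ z
  simpa [moments, hk, L] using this

theorem mem_feasible_iff {C : HermSeq m n} {Φ : discreteCircle N → Matrix (Fin m) (Fin m) ℂ}
    (hΦ : ∀ z, (Φ z).PosDef) : Φ ∈ feasible N C ↔ moments n Φ (fun z => (hΦ z).1) = C := by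
  constructor
  · rintro ⟨-, h⟩
    have hnat : ∀ k : ℕ, (moments n Φ fun z => (hΦ z).1).1 k = C.1 k := by
      intro k
      rcases le_or_gt k n with hk | hk
      · rw [← h k hk]
        simp [moments, hk]
      · rw [coeff_eq_zero _ (by simpa using hk), coeff_eq_zero C (by simpa using hk)]
    refine Subtype.ext (funext fun k => ?_)
    obtain ⟨k, rfl | rfl⟩ := k.eq_nat_or_neg
    · exact hnat k
    · rw [coeff_neg, coeff_neg, hnat]
  · intro h
    refine ⟨hΦ, fun k hk => ?_⟩
    rw [← h]
    simp [moments, hk]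

theorem pairing_of_mem_feasible {C : HermSeq m n}
    {Φ : discreteCircle N → Matrix (Fin m) (Fin m) ℂ} (h : Φ ∈ feasible N C) (Q : HermSeq m n) :
    pairing C Q = nuIntegral fun z => (Φ z * eval Q (z : ℂ)).trace.re := by
  rw [← (mem_feasible_iff h.1).mp h, pairing_moments]

end Pairing

/-! ### Perturbation of positive definite matrices -/

section Perturbation

variable {m : ℕ} {A H : Matrix (Fin m) (Fin m) ℂ}

theorem posSemidef_sub_smul_one (hA : A.IsHermitian) {c : ℝ} (hc : ∀ i, c ≤ hA.eigenvalues i) :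
    (A - c • (1 : Matrix (Fin m) (Fin m) ℂ)).PosSemidef := by
  have hD : (diagonal fun i => ((hA.eigenvalues i - c : ℝ) : ℂ)).PosSemidef :=
    PosSemidef.diagonal fun i => Complex.zero_le_real.mpr (sub_nonneg.mpr (hc i))
  have h := hD.mul_mul_conjTranspose_same (hA.eigenvectorUnitary : Matrix (Fin m) (Fin m) ℂ)
  have hs : (diagonal fun i => ((hA.eigenvalues i - c : ℝ) : ℂ)) =
      diagonal (RCLike.ofReal ∘ hA.eigenvalues) - c • (1 : Matrix (Fin m) (Fin m) ℂ) := by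
    ext i j
    by_cases hij : i = j <;> simp [hij]
  have hU : (hA.eigenvectorUnitary : Matrix (Fin m) (Fin m) ℂ) *
      (hA.eigenvectorUnitary : Matrix (Fin m) (Fin m) ℂ)ᴴ = 1 :=
    Unitary.mul_star_self_of_mem hA.eigenvectorUnitary.2
  have hspec := hA.spectral_theorem
  rw [Unitary.conjStarAlgAut_apply] at hspec
  rw [hs, Matrix.mul_sub, Matrix.sub_mul, Matrix.mul_smul, Matrix.smul_mul, Matrix.mul_one,
    hU] at h
  rw [star_eq_conjTranspose] at hspec
  rwa [← hspec] at h

theorem eventually_posDef_add_smul (hA : A.PosDef) (hH : H.IsHermitian) :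
    ∀ᶠ t : ℝ in 𝓝[>] 0, (A + t • H).PosDef := by
  obtain ⟨ε, hε, hεA⟩ : ∃ ε > 0, ∀ i, ε ≤ hA.1.eigenvalues i := by
    rcases isEmpty_or_nonempty (Fin m) with h | h
    · exact ⟨1, one_pos, fun i => h.elim i⟩
    · obtain ⟨i, hi⟩ := Finite.exists_min hA.1.eigenvalues
      exact ⟨_, hA.eigenvalues_pos i, hi⟩
  obtain ⟨c, hc, hcH⟩ : ∃ c > 0, ∀ i, -c ≤ hH.eigenvalues i := by
    refine ⟨∑ j, |hH.eigenvalues j| + 1, by positivity, fun i => ?_⟩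
    have h1 := Finset.single_le_sum (f := fun j => |hH.eigenvalues j|)
      (fun j _ => abs_nonneg _) (Finset.mem_univ i)
    have h2 := neg_abs_le (hH.eigenvalues i)
    linarith
  filter_upwards [Ioo_mem_nhdsGT (div_pos hε hc)] with t ht
  have htc : 0 < ε - t * c := by rw [sub_pos]; exact (lt_div_iff₀ hc).mp ht.2
  have h1 : ((ε - t * c) • (1 : Matrix (Fin m) (Fin m) ℂ)).PosDef := PosDef.one.smul htc
  have h2 := (h1.add_posSemidef (posSemidef_sub_smul_one hA.1 hεA)).add_posSemidef
    ((posSemidef_sub_smul_one hH hcH).smul ht.1.le)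
  convert h2 using 1
  module

theorem tendsto_trace_inv_add_smul_mul (hA : A.PosDef) :
    Tendsto (fun t : ℝ => ((A + t • H)⁻¹ * H).trace.re) (𝓝[>] 0) (𝓝 (A⁻¹ * H).trace.re) := by
  have hd : A.det ≠ 0 := ((isUnit_iff_isUnit_det _).mp hA.isUnit).ne_zero
  have hinv : ContinuousAt Inv.inv A := by
    refine continuousAt_matrix_inv A ?_
    rw [Ring.inverse_eq_inv']
    exact continuousAt_inv₀ hd
  have hline : Tendsto (fun t : ℝ => A + t • H) (𝓝[>] 0) (𝓝 A) := by
    have : Continuous fun t : ℝ => A + t • H := by fun_prop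
    simpa using (this.tendsto 0).mono_left nhdsWithin_le_nhds
  have hcont : Continuous fun B : Matrix (Fin m) (Fin m) ℂ => (B * H).trace.re := by fun_prop
  exact (hcont.tendsto _).comp (hinv.tendsto.comp hline)

/-- The concavity inequality at `A + tH` bounds the increment of `log det` from below. -/
theorem logDet_add_smul_ge (hA : A.PosDef) {t : ℝ} (ht : (A + t • H).PosDef) :
    logDet A + t * ((A + t • H)⁻¹ * H).trace.re ≤ logDet (A + t • H) := by
  have h := logDet_le ht hA
  have hinv := nonsing_inv_mul _ ((isUnit_iff_isUnit_det _).mp ht.isUnit)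
  have h1 : (A + t • H)⁻¹ * A = 1 - t • ((A + t • H)⁻¹ * H) := by
    rw [← Matrix.mul_smul, eq_sub_iff_add_eq, ← Matrix.mul_add, hinv]
  rw [h1] at h
  simp at h
  linarith

end Perturbation

/-! ### The cones -/

section Cones

variable {m n N : ℕ}

/-- The pseudo-polynomials that are positive semidefinite on the discrete circle. -/
def nonnegCone (m n N : ℕ) : Set (HermSeq m n) :=
  {Q | ∀ z : discreteCircle N, (eval Q (z : ℂ)).PosSemidef}

/-- The constant pseudo-polynomial with value the identity matrix. -/
def constOne (m n : ℕ) : HermSeq m n :=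
  ⟨Pi.single 0 1, fun k => by
    by_cases hk : k = 0
    · simp [hk]
    · simp [hk, neg_eq_zero.not.mpr hk], fun k hk => by
    have : k ≠ 0 := by rintro rfl; simp at hk; omega
    simp [this]⟩

theorem eval_constOne (z : ℂ) : eval (constOne m n) z = 1 := by
  rw [eval, Finset.sum_eq_single 0]
  · simp [constOne]
  · intro k _ hk
    simp [constOne, hk]
  · simp

theorem constOne_mem_posCone : constOne m n ∈ posCone m n N := fun z _ => by
  rw [eval_constOne]
  exact PosDef.one

theorem posCone_subset_nonnegCone : posCone m n N ⊆ nonnegCone m n N :=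
  fun _ hQ z => (hQ z z.2).posSemidef

theorem nonnegCone_subset_closure : nonnegCone m n N ⊆ closure (posCone m n N) := by
  intro Q hQ
  have hlim : Tendsto (fun t : ℝ => Q + t • constOne m n) (𝓝[>] 0) (𝓝 Q) := by
    have : Continuous fun t : ℝ => Q + t • constOne m n := by fun_prop
    simpa using (this.tendsto 0).mono_left nhdsWithin_le_nhds
  refine mem_closure_of_tendsto hlim ?_
  filter_upwards [self_mem_nhdsWithin] with t ht z hz
  rw [eval_add, eval_smul, eval_constOne]
  exact (PosDef.one.smul (Set.mem_Ioi.mp ht)).posSemidef_add (hQ ⟨z, hz⟩)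

/-- The mean of `tr Q` over the discrete circle, which serves as a norm on the cone. -/
def meanTrace (N : ℕ) (Q : HermSeq m n) : ℝ :=
  nuIntegral fun z : discreteCircle N => (eval Q (z : ℂ)).trace.re

theorem continuous_meanTrace : Continuous (meanTrace N : HermSeq m n → ℝ) :=
  continuous_nuIntegral fun z =>
    Complex.continuous_re.comp (continuous_eval (z : ℂ)).matrix_trace

theorem meanTrace_nonneg {Q : HermSeq m n} (hQ : Q ∈ nonnegCone m n N) : 0 ≤ meanTrace N Q :=
  nuIntegral_nonneg fun z => trace_re_nonneg (hQ z)

theorem meanTrace_smul (c : ℝ) (Q : HermSeq m n) : meanTrace N (c • Q) = c * meanTrace N Q := by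
  simp [meanTrace, eval_smul, nuIntegral_mul_left]

theorem smul_mem_nonnegCone {Q : HermSeq m n} (hQ : Q ∈ nonnegCone m n N) {c : ℝ} (hc : 0 ≤ c) :
    c • Q ∈ nonnegCone m n N := fun z => by
  rw [eval_smul]
  exact (hQ z).smul hc

theorem eq_zero_of_meanTrace_eq_zero (hn : n < N) {Q : HermSeq m n}
    (hQ : Q ∈ nonnegCone m n N) (h : meanTrace N Q = 0) : Q = 0 := by
  refine ext_of_eval hn fun z => ?_
  have h0 : (0 : ℝ) = (eval Q (z : ℂ)).trace.re :=
    eq_of_nuIntegral_eq_of_le (N := N) (by omega) (f := fun _ => (0 : ℝ))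
      (fun z => trace_re_nonneg (hQ z)) (by rw [meanTrace] at h; rw [h]; simp [nuIntegral]) z
  have h1 : eval (0 : HermSeq m n) (z : ℂ) = 0 := map_zero (evalLinear m n z)
  rw [h1, ← (hQ z).trace_eq_zero_iff]
  exact Complex.ext h0.symm (Complex.nonneg_iff.mp (hQ z).trace_nonneg).2.symm

theorem isClosed_nonnegCone : IsClosed (nonnegCone m n N) := by
  simp only [nonnegCone, Set.ofPred_forall]
  exact isClosed_iInter fun z => isClosed_posSemidef.preimage (continuous_eval (z : ℂ))

theorem trace_re_le_meanTrace (hN : 0 < N) {Q : HermSeq m n} (hQ : Q ∈ nonnegCone m n N)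
    (z : discreteCircle N) : (eval Q (z : ℂ)).trace.re ≤ 2 * N * meanTrace N Q := by
  obtain ⟨_, j, rfl⟩ := z
  have hN' : (N : ℝ) ≠ 0 := by exact_mod_cast hN.ne'
  rw [meanTrace, nuIntegral, smul_eq_mul, ← mul_assoc, mul_one_div_cancel (by positivity), one_mul]
  exact Finset.single_le_sum
    (f := fun j : Finset.Icc (-(N : ℤ) + 1) (N : ℤ) => (eval Q (zeta N j)).trace.re)
    (fun j _ => trace_re_nonneg (hQ ⟨zeta N j, j, rfl⟩)) (Finset.mem_univ j)

/-- Values on the circle determine the coefficients continuously, so truncations of the cone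
are compact. -/
theorem isCompact_nonnegCone_meanTrace_le (hn : n < N) (R : ℝ) :
    IsCompact (nonnegCone m n N ∩ {Q | meanTrace N Q ≤ R}) := by
  have hK := (isClosedEmbedding_restrict (m := m) hn).isCompact_preimage
    (isCompact_univ_pi fun _ : discreteCircle N =>
      isCompact_posSemidef_trace_le (m := m) (2 * N * R))
  refine hK.of_isClosed_subset
    (isClosed_nonnegCone.inter (isClosed_le continuous_meanTrace continuous_const)) ?_
  rintro Q ⟨hQ, hR⟩ z -
  refine ⟨hQ z, (trace_re_le_meanTrace (by omega) hQ z).trans ?_⟩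
  exact mul_le_mul_of_nonneg_left hR (by positivity)

theorem exists_meanTrace_le_pairing (hn : n < N) {C : HermSeq m n} (hC : C ∈ dualCone m n N) :
    ∃ c > 0, ∀ Q ∈ nonnegCone m n N, c * meanTrace N Q ≤ pairing C Q := by
  have hS : IsCompact (nonnegCone m n N ∩ {Q | meanTrace N Q = 1}) :=
    (isCompact_nonnegCone_meanTrace_le hn 1).of_isClosed_subset
      (isClosed_nonnegCone.inter (isClosed_eq continuous_meanTrace continuous_const))
      (Set.inter_subset_inter_right _ fun Q (hQ : meanTrace N Q = 1) => hQ.le)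
  obtain ⟨c, hc, hcS⟩ : ∃ c > 0, ∀ Q ∈ nonnegCone m n N, meanTrace N Q = 1 → c ≤ pairing C Q := by
    rcases (nonnegCone m n N ∩ {Q | meanTrace N Q = 1}).eq_empty_or_nonempty with h | h
    · exact ⟨1, one_pos, fun Q hQ h1 => (Set.notMem_empty Q (h ▸ ⟨hQ, h1⟩)).elim⟩
    · obtain ⟨Q, ⟨hQ, hQ1⟩, hmin⟩ := hS.exists_isMinOn h (continuous_pairing C).continuousOn
      refine ⟨pairing C Q, hC Q ⟨nonnegCone_subset_closure hQ, ?_⟩, fun R hR hR1 => hmin ⟨hR, hR1⟩⟩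
      rintro rfl
      have := meanTrace_smul (N := N) 0 (0 : HermSeq m n)
      rw [smul_zero, zero_mul] at this
      exact zero_ne_one (this.symm.trans hQ1)
  refine ⟨c, hc, fun Q hQ => ?_⟩
  rcases (meanTrace_nonneg hQ).eq_or_lt with h0 | hpos
  · rw [eq_zero_of_meanTrace_eq_zero hn hQ h0.symm]
    simp [meanTrace, nuIntegral, eval, pairing]
  · have h := hcS _ (smul_mem_nonnegCone hQ (inv_nonneg.mpr hpos.le))
      (by rw [meanTrace_smul, inv_mul_cancel₀ hpos.ne'])
    rw [pairing_smul_right, ← div_eq_inv_mul] at h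
    exact (le_div_iff₀ hpos).mp h

theorem scalarEval_pos {P : HermSeq 1 n} (hP : P ∈ posCone 1 n N) (z : discreteCircle N) :
    0 < scalarEval P (z : ℂ) :=
  (Complex.pos_iff.mp (hP z z.2).diag_pos).1

end Cones

/-! ### The dual problem -/

section Dual

variable {m n N : ℕ} {C : HermSeq m n} {P : HermSeq 1 n}

/-- Linear growth of the pairing beats the logarithm. -/
theorem exists_dual_ge (hn : n < N) (hC : C ∈ dualCone m n N) (hP : P ∈ posCone 1 n N) :
    ∃ a > 0, ∃ K, ∀ Q ∈ posCone m n N, a * meanTrace N Q - K ≤ dual N C P Q := by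
  obtain ⟨c, hc, hcC⟩ := exists_meanTrace_le_pairing hn hC
  obtain ⟨M, hM, hPM⟩ : ∃ M > 0, ∀ z : discreteCircle N, scalarEval P (z : ℂ) ≤ M := by
    obtain ⟨M, hM⟩ := (Set.finite_range fun z : discreteCircle N =>
      scalarEval P (z : ℂ)).bddAbove
    exact ⟨max M 1, lt_max_of_lt_right one_pos,
      fun z => (hM (Set.mem_range_self z)).trans (le_max_left _ _)⟩
  -- The tangent hyperplane of `log det` is taken at `t • 1`, with slope `t⁻¹` so small that
  -- `P / t ≤ c / 2` on the circle.
  set t : ℝ := 2 * M / c with ht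
  have htpos : 0 < t := by positivity
  have hA : (t • (1 : Matrix (Fin m) (Fin m) ℂ)).PosDef := PosDef.one.smul htpos
  have hAinv : (t • (1 : Matrix (Fin m) (Fin m) ℂ))⁻¹ = t⁻¹ • 1 :=
    inv_eq_left_inv (by simp [smul_smul, htpos.ne'])
  set L : ℝ := logDet (t • (1 : Matrix (Fin m) (Fin m) ℂ)) - m
  refine ⟨c / 2, by positivity,
    nuIntegral fun z : discreteCircle N => scalarEval P (z : ℂ) * L, fun Q hQ => ?_⟩
  have hpt : ∀ z : discreteCircle N, scalarEval P (z : ℂ) * logDet (eval Q (z : ℂ)) ≤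
      scalarEval P (z : ℂ) * L + c / 2 * (eval Q (z : ℂ)).trace.re := by
    intro z
    have hp := scalarEval_pos hP z
    have hE := hQ z z.2
    have h := logDet_le hA hE
    rw [hAinv, Matrix.smul_mul, Matrix.one_mul, trace_smul, Complex.smul_re, smul_eq_mul] at h
    have hslope : scalarEval P (z : ℂ) * t⁻¹ ≤ c / 2 := by
      calc scalarEval P (z : ℂ) * t⁻¹ ≤ M * t⁻¹ := by gcongr; exact hPM z
        _ = c / 2 := by rw [ht]; field_simp
    calc scalarEval P (z : ℂ) * logDet (eval Q (z : ℂ))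
        ≤ scalarEval P (z : ℂ) * (L + t⁻¹ * (eval Q (z : ℂ)).trace.re) := by
          gcongr; simp only [L]; linarith
      _ = scalarEval P (z : ℂ) * L +
          scalarEval P (z : ℂ) * t⁻¹ * (eval Q (z : ℂ)).trace.re := by ring
      _ ≤ _ := by gcongr; exact trace_re_nonneg hE.posSemidef
  have h1 := nuIntegral_mono hpt
  rw [nuIntegral_add, nuIntegral_mul_left] at h1
  have h2 := hcC Q (posCone_subset_nonnegCone hQ)
  rw [dual]
  rw [← meanTrace] at h1
  linarith

/-- The function `exp (-𝕁_P)`, extended by zero to the positive semidefinite pseudo-polynomials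
that are singular somewhere on the discrete circle. -/
def expNegDual (N : ℕ) (C : HermSeq m n) (P : HermSeq 1 n) (Q : HermSeq m n) : ℝ :=
  Real.exp (-pairing C Q) * ∏ j : Finset.Icc (-(N : ℤ) + 1) (N : ℤ),
    (eval Q (zeta N j)).det.re ^ (1 / (2 * (N : ℝ)) * scalarEval P (zeta N j))

theorem expNegDual_eq {Q : HermSeq m n} (hQ : Q ∈ posCone m n N) :
    expNegDual N C P Q = Real.exp (-dual N C P Q) := by
  rw [expNegDual, dual, neg_sub, sub_eq_neg_add, Real.exp_add, nuIntegral,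
    smul_eq_mul, Finset.mul_sum, Real.exp_sum]
  congr 1
  refine Finset.prod_congr rfl fun j _ => ?_
  rw [Real.rpow_def_of_pos (det_re_pos (hQ _ ⟨j, rfl⟩)), logDet]
  ring_nf

theorem continuous_expNegDual (hP : P ∈ posCone 1 n N) :
    Continuous (expNegDual N C P) := by
  refine (Real.continuous_exp.comp (continuous_pairing C).neg).mul
    (continuous_finsetProd _ fun j _ => ?_)
  refine (Complex.continuous_re.comp (continuous_eval _).matrix_det).rpow_const fun _ => Or.inr ?_
  have := (scalarEval_pos hP ⟨zeta N j, j, rfl⟩).le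
  positivity

theorem mem_posCone_of_expNegDual_pos (hN : 0 < N) (hP : P ∈ posCone 1 n N) {Q : HermSeq m n}
    (hQ : Q ∈ nonnegCone m n N) (h : 0 < expNegDual N C P Q) : Q ∈ posCone m n N := by
  rintro _ ⟨j, rfl⟩
  rw [(hQ ⟨zeta N j, j, rfl⟩).posDef_iff_det_ne_zero]
  intro hdet
  have hp := scalarEval_pos hP ⟨zeta N j, j, rfl⟩
  refine h.ne' (mul_eq_zero_of_right _ (Finset.prod_eq_zero (Finset.mem_univ j) ?_))
  simp only at hdet hp
  rw [hdet, Complex.zero_re, Real.zero_rpow (by positivity)]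

theorem exists_isMinOn_dual (hn : n < N) (hC : C ∈ dualCone m n N) (hP : P ∈ posCone 1 n N) :
    ∃ Q ∈ posCone m n N, IsMinOn (dual N C P) (posCone m n N) Q := by
  obtain ⟨a, ha, K, hK⟩ := exists_dual_ge hn hC hP
  have h1 : constOne m n ∈ posCone m n N := constOne_mem_posCone
  -- Outside `meanTrace N Q ≤ R` the functional exceeds its value at `constOne m n`.
  set R : ℝ := max (meanTrace N (constOne m n)) ((dual N C P (constOne m n) + K) / a)
  obtain ⟨Q, ⟨hQ, -⟩, hmax⟩ := (isCompact_nonnegCone_meanTrace_le (m := m) hn R).exists_isMaxOn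
    ⟨constOne m n, posCone_subset_nonnegCone h1, le_max_left (meanTrace N (constOne m n)) _⟩
    (continuous_expNegDual (C := C) hP).continuousOn
  have hle : ∀ S ∈ posCone m n N, meanTrace N S ≤ R →
      Real.exp (-dual N C P S) ≤ expNegDual N C P Q := fun S hS hSR => by
    rw [← expNegDual_eq hS]
    exact hmax ⟨posCone_subset_nonnegCone hS, hSR⟩
  have hQpos : Q ∈ posCone m n N := mem_posCone_of_expNegDual_pos (by omega) hP hQ
    ((Real.exp_pos _).trans_le (hle _ h1 (le_max_left _ _)))
  simp only [expNegDual_eq hQpos, Real.exp_le_exp, neg_le_neg_iff] at hle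
  refine ⟨Q, hQpos, fun S hS => ?_⟩
  rcases le_or_gt (meanTrace N S) R with hSR | hSR
  · exact hle S hS hSR
  · refine (hle _ h1 (le_max_left _ _)).trans ?_
    have h2 := (le_max_right _ _).trans_lt hSR
    rw [div_lt_iff₀ ha] at h2
    have h3 := hK S hS
    linarith

/-- One half of the stationarity condition; the other half is this one for `-H`. -/
theorem pairing_ge_of_isMinOn {Q : HermSeq m n} (hP : P ∈ posCone 1 n N)
    (hQ : Q ∈ posCone m n N) (hmin : IsMinOn (dual N C P) (posCone m n N) Q) (H : HermSeq m n) :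
    (nuIntegral fun z : discreteCircle N =>
      scalarEval P (z : ℂ) * ((eval Q (z : ℂ))⁻¹ * eval H (z : ℂ)).trace.re) ≤ pairing C H := by
  have hpos : ∀ᶠ t : ℝ in 𝓝[>] 0, ∀ z : discreteCircle N,
      (eval Q (z : ℂ) + t • eval H (z : ℂ)).PosDef :=
    eventually_all.mpr fun z => eventually_posDef_add_smul (hQ z z.2) (isHermitian_eval H z)
  have hlim : Tendsto (fun t : ℝ => nuIntegral fun z : discreteCircle N => scalarEval P (z : ℂ) *
        ((eval Q (z : ℂ) + t • eval H (z : ℂ))⁻¹ * eval H (z : ℂ)).trace.re) (𝓝[>] 0)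
      (𝓝 (nuIntegral fun z : discreteCircle N =>
        scalarEval P (z : ℂ) * ((eval Q (z : ℂ))⁻¹ * eval H (z : ℂ)).trace.re)) :=
    (tendsto_finsetSum _ fun j _ =>
      (tendsto_trace_inv_add_smul_mul (hQ _ ⟨j, rfl⟩)).const_mul _).const_smul _
  refine le_of_tendsto hlim ?_
  filter_upwards [hpos, self_mem_nhdsWithin] with t ht ht0
  have hmem : Q + t • H ∈ posCone m n N := fun z hz => by
    rw [eval_add, eval_smul]
    exact ht ⟨z, hz⟩
  have h := isMinOn_iff.mp hmin _ hmem
  rw [dual, dual, pairing_add_right, pairing_smul_right] at h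
  have h1 : (nuIntegral fun z : discreteCircle N =>
      scalarEval P (z : ℂ) * logDet (eval Q (z : ℂ)) + t * (scalarEval P (z : ℂ) *
        ((eval Q (z : ℂ) + t • eval H (z : ℂ))⁻¹ * eval H (z : ℂ)).trace.re)) ≤
      nuIntegral fun z : discreteCircle N =>
        scalarEval P (z : ℂ) * logDet (eval (Q + t • H) (z : ℂ)) := by
    refine nuIntegral_mono fun z => ?_
    rw [eval_add, eval_smul]
    have := mul_le_mul_of_nonneg_left (logDet_add_smul_ge (hQ z z.2) (ht z))
      (scalarEval_pos hP z).le
    linarith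
  rw [nuIntegral_add, nuIntegral_mul_left] at h1
  exact le_of_mul_le_mul_left (by linarith) (Set.mem_Ioi.mp ht0)

/-- Stationarity: the gradient `C - ∫ P Q⁻¹` of the dual functional vanishes at a minimizer. -/
theorem pairing_eq_of_isMinOn {Q : HermSeq m n} (hP : P ∈ posCone 1 n N)
    (hQ : Q ∈ posCone m n N) (hmin : IsMinOn (dual N C P) (posCone m n N) Q) (H : HermSeq m n) :
    pairing C H = nuIntegral fun z : discreteCircle N =>
      scalarEval P (z : ℂ) * ((eval Q (z : ℂ))⁻¹ * eval H (z : ℂ)).trace.re := by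
  refine le_antisymm ?_ (pairing_ge_of_isMinOn hP hQ hmin H)
  have h := pairing_ge_of_isMinOn hP hQ hmin ((-1 : ℝ) • H)
  simp only [pairing_smul_right, eval_smul, Matrix.mul_smul, trace_smul, Complex.smul_re,
    smul_eq_mul, mul_left_comm _ (-1 : ℝ), nuIntegral_mul_left] at h
  linarith

theorem eq_of_isMinOn_dual (hn : n < N) (hP : P ∈ posCone 1 n N) {Q R : HermSeq m n}
    (hQ : Q ∈ posCone m n N) (hQmin : IsMinOn (dual N C P) (posCone m n N) Q)
    (hR : R ∈ posCone m n N) (hRmin : IsMinOn (dual N C P) (posCone m n N) R) : R = Q := by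
  have hdual : dual N C P R = dual N C P Q :=
    le_antisymm (isMinOn_iff.mp hRmin Q hQ) (isMinOn_iff.mp hQmin R hR)
  have hstat := pairing_eq_of_isMinOn hP hQ hQmin (R - Q)
  have htrace : ∀ z : discreteCircle N,
      ((eval Q (z : ℂ))⁻¹ * eval (R - Q) (z : ℂ)).trace.re =
        ((eval Q (z : ℂ))⁻¹ * eval R (z : ℂ)).trace.re - m := fun z => by
    rw [eval_sub, Matrix.mul_sub,
      nonsing_inv_mul _ ((isUnit_iff_isUnit_det _).mp (hQ z z.2).isUnit)]
    simp
  simp only [htrace, pairing_sub_right] at hstat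
  have hint : (nuIntegral fun z : discreteCircle N =>
      scalarEval P (z : ℂ) * logDet (eval R (z : ℂ))) =
      nuIntegral fun z : discreteCircle N => scalarEval P (z : ℂ) * logDet (eval Q (z : ℂ)) +
        scalarEval P (z : ℂ) * (((eval Q (z : ℂ))⁻¹ * eval R (z : ℂ)).trace.re - m) := by
    rw [nuIntegral_add, ← hstat]
    rw [dual, dual] at hdual
    linarith
  refine ext_of_eval hn fun z => eq_of_logDet_eq (hQ z z.2) (hR z z.2) ?_
  have hz := eq_of_nuIntegral_eq_of_le (by omega) (fun z => ?_) hint z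
  · simp only [← mul_add] at hz
    exact mul_left_cancel₀ (scalarEval_pos hP z).ne' hz
  · simp only [← mul_add]
    exact mul_le_mul_of_nonneg_left (logDet_le (hQ z z.2) (hR z z.2)) (scalarEval_pos hP z).le

end Dual

/-! ### The primal problem -/

section Primal

variable {m n N : ℕ} {C : HermSeq m n} {P : HermSeq 1 n} {Q : HermSeq m n}

theorem posDef_ratio (hP : P ∈ posCone 1 n N) (hQ : Q ∈ posCone m n N) (z : discreteCircle N) :
    (ratio N P Q z).PosDef :=
  (hQ z z.2).inv.smul (Complex.zero_lt_real.mpr (scalarEval_pos hP z))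

/-- By stationarity the moments of `P Q⁻¹` pair with every pseudo-polynomial as `C` does, in
particular with the difference of the two. -/
theorem ratio_mem_feasible (hP : P ∈ posCone 1 n N) (hQ : Q ∈ posCone m n N)
    (hmin : IsMinOn (dual N C P) (posCone m n N) Q) : ratio N P Q ∈ feasible N C := by
  rw [mem_feasible_iff (posDef_ratio hP hQ)]
  set D := moments n (ratio N P Q) fun z => (posDef_ratio hP hQ z).1
  have h : ∀ H, pairing D H = pairing C H := fun H => by
    rw [pairing_moments, pairing_eq_of_isMinOn hP hQ hmin]
    simp [ratio]
  rw [← sub_eq_zero]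
  apply eq_zero_of_pairing_self
  rw [pairing_sub_left, h, sub_self]

theorem trace_inv_ratio_mul (hP : P ∈ posCone 1 n N) (hQ : Q ∈ posCone m n N)
    (z : discreteCircle N) (A : Matrix (Fin m) (Fin m) ℂ) :
    scalarEval P (z : ℂ) * ((ratio N P Q z)⁻¹ * A).trace.re =
      (A * eval Q (z : ℂ)).trace.re := by
  have hp : (scalarEval P (z : ℂ) : ℂ) ≠ 0 := by exact_mod_cast (scalarEval_pos hP z).ne'
  have hu := (isUnit_iff_isUnit_det _).mp (hQ z z.2).isUnit
  have hinv : (ratio N P Q z)⁻¹ = (scalarEval P (z : ℂ) : ℂ)⁻¹ • eval Q (z : ℂ) :=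
    inv_eq_left_inv (by
      rw [ratio, Matrix.smul_mul, Matrix.mul_smul, smul_smul, inv_mul_cancel₀ hp, one_smul,
        mul_nonsing_inv _ hu])
  have hp' := (scalarEval_pos hP z).ne'
  rw [hinv, Matrix.smul_mul, trace_smul, smul_eq_mul, ← Complex.ofReal_inv, Complex.re_ofReal_mul,
    mul_inv_cancel_left₀ hp', trace_mul_comm]

theorem primal_integrand_le (hP : P ∈ posCone 1 n N) (hQ : Q ∈ posCone m n N)
    {Φ : discreteCircle N → Matrix (Fin m) (Fin m) ℂ} (hΦ : ∀ z, (Φ z).PosDef)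
    (z : discreteCircle N) :
    scalarEval P (z : ℂ) * logDet (Φ z) ≤ scalarEval P (z : ℂ) *
      (logDet (ratio N P Q z) + (((ratio N P Q z)⁻¹ * Φ z).trace.re - m)) :=
  mul_le_mul_of_nonneg_left (logDet_le (posDef_ratio hP hQ z) (hΦ z)) (scalarEval_pos hP z).le

/-- All feasible `Φ` give the same value to the linearization of `𝕀_P` at `P Q⁻¹`, because its
slope `P (P Q⁻¹)⁻¹ = Q` sees only the moments. -/
theorem nuIntegral_linearization (hP : P ∈ posCone 1 n N) (hQ : Q ∈ posCone m n N)
    (hr : ratio N P Q ∈ feasible N C)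
    {Φ : discreteCircle N → Matrix (Fin m) (Fin m) ℂ} (hΦ : Φ ∈ feasible N C) :
    (nuIntegral fun z : discreteCircle N => scalarEval P (z : ℂ) *
      (logDet (ratio N P Q z) + (((ratio N P Q z)⁻¹ * Φ z).trace.re - m))) =
      primal P (ratio N P Q) := by
  have hm : ∀ z : discreteCircle N,
      (ratio N P Q z * eval Q (z : ℂ)).trace.re = scalarEval P (z : ℂ) * m := fun z => by
    rw [← trace_inv_ratio_mul hP hQ,
      nonsing_inv_mul _ ((isUnit_iff_isUnit_det _).mp (posDef_ratio hP hQ z).isUnit)]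
    simp
  have h := (pairing_of_mem_feasible hΦ Q).symm.trans (pairing_of_mem_feasible hr Q)
  simp only [mul_add, mul_sub, trace_inv_ratio_mul hP hQ, ← hm, nuIntegral_add, nuIntegral_sub, h,
    sub_self, add_zero, primal]

theorem isMaxOn_primal (hP : P ∈ posCone 1 n N) (hQ : Q ∈ posCone m n N)
    (hr : ratio N P Q ∈ feasible N C) :
    IsMaxOn (primal P) (feasible N C) (ratio N P Q) := fun _ hΦ =>
  (nuIntegral_mono (primal_integrand_le hP hQ hΦ.1)).trans_eq
    (nuIntegral_linearization hP hQ hr hΦ)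

theorem eq_ratio_of_isMaxOn (hN : 0 < N) (hP : P ∈ posCone 1 n N) (hQ : Q ∈ posCone m n N)
    (hr : ratio N P Q ∈ feasible N C) {Φ : discreteCircle N → Matrix (Fin m) (Fin m) ℂ}
    (hΦ : Φ ∈ feasible N C) (hmax : IsMaxOn (primal P) (feasible N C) Φ) :
    Φ = ratio N P Q := by
  have h : primal P Φ = primal P (ratio N P Q) :=
    le_antisymm (isMaxOn_iff.mp (isMaxOn_primal hP hQ hr) Φ hΦ) (isMaxOn_iff.mp hmax _ hr)
  rw [← nuIntegral_linearization hP hQ hr hΦ] at h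
  funext z
  exact eq_of_logDet_eq (posDef_ratio hP hQ z) (hΦ.1 z)
    (mul_left_cancel₀ (scalarEval_pos hP z).ne'
      (eq_of_nuIntegral_eq_of_le hN (primal_integrand_le hP hQ hΦ.1) h z))

end Primal

end PeriodicMoment

end

open PeriodicMoment
theorem theorem8 (m n N : ℕ) (hm : 0 < m) (hn : n < N)
    (C : HermSeq m n) (hC : C ∈ dualCone m n N)
    (P : HermSeq 1 n) (hP : P ∈ posCone 1 n N) :
    ∃ Qhat ∈ posCone m n N,
      -- the dual problem has the unique solution `Qhat`
      (IsMinOn (dual N C P) (posCone m n N) Qhat ∧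
        ∀ Q ∈ posCone m n N, IsMinOn (dual N C P) (posCone m n N) Q → Q = Qhat) ∧
      -- the primal problem has the unique solution `P Qhat⁻¹`
      (ratio N P Qhat ∈ feasible N C ∧
        IsMaxOn (primal P) (feasible N C) (ratio N P Qhat) ∧
        ∀ Φ ∈ feasible N C, IsMaxOn (primal P) (feasible N C) Φ → Φ = ratio N P Qhat) := by
  obtain ⟨Q, hQ, hmin⟩ := exists_isMinOn_dual hn hC hP
  have hr := ratio_mem_feasible hP hQ hmin
  exact ⟨Q, hQ, ⟨hmin, fun R hR hRmin => eq_of_isMinOn_dual hn hP hQ hmin hR hRmin⟩, hr,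
    isMaxOn_primal hP hQ hr, fun Φ hΦ hmax => eq_ratio_of_isMaxOn (by omega) hP hQ hr hΦ hmax⟩
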